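/- Let $\mathcal S^2$ be the space of real symmetric $2\times 2$ matrices and let $b_0\ge 0$. For $Q=(q_{ij})\in\mathcal S^2$ and $y=(y_1,y_2)\in\mathbb R^2$ put $$F(Q,y)=\operatorname{tr}Q+b(y_1)\,\lambda_{\max}^+(Q),$$ where $\lambda_{\max}(Q)$ is the largest eigenvalue of $Q$, $s^+=\max\{s,0\}$, and $b$ is the $1$-periodic function with $b=0$ on $[0,\tfrac12)$ and $b=b_0$ on $[\tfrac12,1)$ (stripes). Then for every $Q\in\mathcal S^2$ there is exactly one real number $\overline F(Q)$ for which the cell problem $$F(Q+D^2u(y),y)=\overline F(Q),\qquad y\in\mathbb R^2,$$ has a continuous $\mathbb Z^2$-periodic viscosity solution $u$. (Since $F$ is discontinuous in $y$, viscosity subsolutions are tested with the upper semicontinuous envelope $F^*$, by $F^*(Q+X,y)\ge\overline F(Q)$ for $X$ in the second-order superjet of $u$ at $y$, and supersolutions with the lower semicontinuous envelope $F_*$, by $F_*(Q+X,y)\le\overline F(Q)$ for $X$ in the second-order subjet.) This homogenized value satisfies: 1. If $Q$ is not negative semidefinite, then $$\overline F(Q)\ \ge\ \sup_{t\in[0,1]}\left\{\operatorname{tr}Q+\frac{b_0}{2+b_0t}\Big(q_{22}+t\,(q_{11}-q_{22})+2q_{12}\sqrt{t-t^2}\Big)\right\},$$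 where the supremum is finite. 2. If $Q$ is negative semidefinite, then $F(Q,y)=\operatorname{tr}Q$ for all $y$ and $\overline F(Q)=\operatorname{HM}(a)\operatorname{tr}Q=\operatorname{tr}Q$, where $a\equiv1$ is the coefficient of $\operatorname{tr}Q$ in $F$ and $\operatorname{HM}(a)=\big(\int_{[0,1]^2}a(y)^{-1}\,dy\big)^{-1}=1$ is its harmonic mean. -/

import Mathlib

open Filter Topology MeasureTheory Set

noncomputable section

namespace StripeHomog

/-- Real symmetric `d × d` matrices, with the topology inherited from the space of matrices. -/
abbrev SymMat (d : ℕ) : Type := selfAdjoint (Matrix (Fin d) (Fin d) ℝ)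

/-- The largest eigenvalue of a symmetric matrix. -/
def lambdaMax {d : ℕ} (Q : SymMat d) : ℝ :=
  sSup {μ : ℝ | Module.End.HasEigenvalue (Matrix.toLin' (Q : Matrix (Fin d) (Fin d) ℝ)) μ}

/-- The second-order superjet of `u` at `y` (its matrix part): `X` belongs to it if, for some `p`,
`u (y + h) ≤ u y + p ⬝ h + (1/2) h ⬝ X h + o(|h|²)` as `h → 0`. -/
def IsSuperjet {d : ℕ} (u : (Fin d → ℝ) → ℝ) (y : Fin d → ℝ) (X : SymMat d) : Prop :=
  ∃ p : Fin d → ℝ, ∀ ε : ℝ, 0 < ε → ∀ᶠ h in 𝓝 (0 : Fin d → ℝ),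
    u (y + h) ≤ u y + p ⬝ᵥ h
      + (1 / 2) * (h ⬝ᵥ ((X : Matrix (Fin d) (Fin d) ℝ).mulVec h)) + ε * (h ⬝ᵥ h)

/-- The second-order subjet of `u` at `y` (its matrix part): `X` belongs to it if, for some `p`,
`u (y + h) ≥ u y + p ⬝ h + (1/2) h ⬝ X h - o(|h|²)` as `h → 0`. -/
def IsSubjet {d : ℕ} (u : (Fin d → ℝ) → ℝ) (y : Fin d → ℝ) (X : SymMat d) : Prop :=
  ∃ p : Fin d → ℝ, ∀ ε : ℝ, 0 < ε → ∀ᶠ h in 𝓝 (0 : Fin d → ℝ),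
    u y + p ⬝ᵥ h
      + (1 / 2) * (h ⬝ᵥ ((X : Matrix (Fin d) (Fin d) ℝ).mulVec h)) - ε * (h ⬝ᵥ h) ≤ u (y + h)

/-- The upper semicontinuous envelope of an operator `F (X, y)`, jointly in `X` and `y`. -/
def upperEnv {d : ℕ} (F : SymMat d → (Fin d → ℝ) → ℝ) (X : SymMat d) (y : Fin d → ℝ) : EReal :=
  limsup (fun z : SymMat d × (Fin d → ℝ) => ((F z.1 z.2 : ℝ) : EReal)) (𝓝 (X, y))

/-- The lower semicontinuous envelope of an operator `F (X, y)`, jointly in `X` and `y`. -/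
def lowerEnv {d : ℕ} (F : SymMat d → (Fin d → ℝ) → ℝ) (X : SymMat d) (y : Fin d → ℝ) : EReal :=
  liminf (fun z : SymMat d × (Fin d → ℝ) => ((F z.1 z.2 : ℝ) : EReal)) (𝓝 (X, y))

/-- Continuous viscosity solutions of `F (D²u, y) = c` on the whole space, for an operator `F`
that is nondecreasing in its matrix argument and possibly discontinuous in `y`
(subsolutions are tested with the upper envelope, supersolutions with the lower one). -/
structure IsViscositySolution {d : ℕ} (F : SymMat d → (Fin d → ℝ) → ℝ) (c : ℝ)
    (u : (Fin d → ℝ) → ℝ) : Prop where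
  continuous : Continuous u
  subsolution : ∀ y X, IsSuperjet u y X → (c : EReal) ≤ upperEnv F X y
  supersolution : ∀ y X, IsSubjet u y X → lowerEnv F X y ≤ (c : EReal)

/-- Functions on the unit torus, seen as `ℤ^d`-periodic functions. -/
def IsPeriodic {d : ℕ} (u : (Fin d → ℝ) → ℝ) : Prop :=
  ∀ (y : Fin d → ℝ) (k : Fin d → ℤ), u (y + fun i => (k i : ℝ)) = u y

/-- `c` is a value of the cell problem of `F` at `Q`: the equation `F (Q + D²u, y) = c` has a
periodic viscosity solution `u`. -/
def IsCellValue {d : ℕ} (F : SymMat d → (Fin d → ℝ) → ℝ) (Q : SymMat d) (c : ℝ) : Prop :=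
  ∃ u : (Fin d → ℝ) → ℝ, IsPeriodic u ∧ IsViscositySolution (fun X y => F (Q + X) y) c u

/-- The convex Pucci type operator `F^{A,a}(Q, y) = a(y) tr Q + (A(y) - a(y)) λ_max⁺(Q)`. -/
def pucci {d : ℕ} (A a : (Fin d → ℝ) → ℝ) (Q : SymMat d) (y : Fin d → ℝ) : ℝ :=
  a y * (Q : Matrix (Fin d) (Fin d) ℝ).trace + (A y - a y) * max (lambdaMax Q) 0

/-- The stripe coefficient: `1`-periodic in `y₁`, equal to `0` on the first half of each period
and to `b₀` on the second half. -/
def stripeB (b₀ : ℝ) (y : Fin 2 → ℝ) : ℝ :=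
  if Int.fract (y 0) < 1 / 2 then 0 else b₀

/-- The stripe coefficient `a ≡ 1`. -/
def stripeA : (Fin 2 → ℝ) → ℝ := fun _ => 1

/-- The Pucci type operator on stripes: `a ≡ 1` and `A = a + b`. -/
def stripeOp (b₀ : ℝ) : SymMat 2 → (Fin 2 → ℝ) → ℝ :=
  pucci (fun y => stripeA y + stripeB b₀ y) stripeA

/-- The harmonic mean of a function over the unit cell. -/
def harmonicMean {d : ℕ} (a : (Fin d → ℝ) → ℝ) : ℝ :=
  (∫ y in Icc (0 : Fin d → ℝ) 1, (a y)⁻¹)⁻¹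

/-- `L̄_t(Q) = tr Q + b₀ / (2 + b₀ t) * (q₂₂ + t (q₁₁ - q₂₂) + 2 q₁₂ √(t - t²))`. -/
def stripeL (b₀ : ℝ) (Q : SymMat 2) (t : ℝ) : ℝ :=
  (Q : Matrix (Fin 2) (Fin 2) ℝ).trace + b₀ / (2 + b₀ * t) *
    (Q.1 1 1 + t * (Q.1 0 0 - Q.1 1 1) + 2 * Q.1 0 1 * √(t - t ^ 2))

end StripeHomog

end

open Filter Topology MeasureTheory Set

namespace StripeHomog

/-! The coefficient depends on `y₁` alone, so a corrector is sought as a laminate `u(y) = v(y₁)`,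
with `v'' = s` where `b = 0` and `v'' = -s` where `b = b₀`. The stripes have equal width, so `v` is
periodic and `C¹`. The operator takes the value `tr Q + s` on the first stripe and `tr Q - s + b₀
λ⁺(Q - s e₁⊗e₁)` on the second. They agree iff `2s = b₀ λ⁺(Q - s e₁⊗e₁)`, which has a root `s ≥ 0`
by the intermediate value theorem (`exists_isCorrectorSlope`); then `tr Q + s` is a cell value
(`IsCorrectorSlope.isCellValue`).

Uniqueness compares an arbitrary periodic solution with the profile whose second derivatives are
raised by `η > 0`. The raised profile has concave kinks on the interfaces, where any second
derivative is admissible in a test from above; this disposes of the jump of `F`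
(`IsCorrectorSlope.cellValue_le`, and `IsCorrectorSlope.le_cellValue` for `-u`).

Testing `λ⁺(Q - s e₁⊗e₁)` with the unit vector `(√t, √(1-t))` and solving for `s` gives the lower
bound. For `Q ≤ 0` the relation forces `s = 0`. -/

/-! ### The largest eigenvalue of a symmetric `2 × 2` matrix -/

/-- The quadratic form of a symmetric matrix. -/
def quadForm {d : ℕ} (X : SymMat d) (h : Fin d → ℝ) : ℝ :=
  h ⬝ᵥ ((X : Matrix (Fin d) (Fin d) ℝ).mulVec h)

lemma SymMat.apply_comm {d : ℕ} (X : SymMat d) (i j : Fin d) : X.1 i j = X.1 j i := by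
  have h := congrFun (congrFun X.2.star_eq j) i
  simpa [Matrix.star_apply] using h

lemma quadForm_two (X : SymMat 2) (h : Fin 2 → ℝ) :
    quadForm X h = X.1 0 0 * h 0 ^ 2 + 2 * X.1 0 1 * (h 0 * h 1) + X.1 1 1 * h 1 ^ 2 := by
  simp only [quadForm, dotProduct, Matrix.mulVec, Fin.sum_univ_two, X.apply_comm 1 0]
  ring

lemma quadForm_add {d : ℕ} (X Y : SymMat d) (h : Fin d → ℝ) :
    quadForm (X + Y) h = quadForm X h + quadForm Y h := by
  simp [quadForm, Matrix.add_mulVec, dotProduct_add]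

lemma quadForm_neg {d : ℕ} (X : SymMat d) (h : Fin d → ℝ) : quadForm (-X) h = -quadForm X h := by
  have : (-X).1 = -X.1 := rfl
  simp only [quadForm, this, Matrix.neg_mulVec, dotProduct_neg]

lemma quadForm_smul_vec {d : ℕ} (X : SymMat d) (t : ℝ) (h : Fin d → ℝ) :
    quadForm X (t • h) = t ^ 2 * quadForm X h := by
  simp only [quadForm, Matrix.mulVec_smul, smul_dotProduct, dotProduct_smul, smul_eq_mul]
  ring

lemma lambdaMax_two (Q : SymMat 2) :
    lambdaMax Q =
      (Q.1 0 0 + Q.1 1 1 + √((Q.1 0 0 - Q.1 1 1) ^ 2 + 4 * Q.1 0 1 ^ 2)) / 2 := by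
  set D := (Q.1 0 0 - Q.1 1 1) ^ 2 + 4 * Q.1 0 1 ^ 2 with hD
  have hD0 : 0 ≤ D := by positivity
  have hs := Real.sq_sqrt hD0
  have key : ∀ μ : ℝ, Module.End.HasEigenvalue
      (Matrix.toLin' (Q : Matrix (Fin 2) (Fin 2) ℝ)) μ ↔ (2 * μ - Q.1 0 0 - Q.1 1 1) ^ 2 = D := by
    intro μ
    rw [Module.End.hasEigenvalue_iff_isRoot_charpoly, Matrix.charpoly_toLin',
      Matrix.charpoly_fin_two, Polynomial.IsRoot.def]
    simp only [Polynomial.eval_add, Polynomial.eval_sub, Polynomial.eval_mul, Polynomial.eval_pow,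
      Polynomial.eval_X, Polynomial.eval_C, Matrix.trace_fin_two, Matrix.det_fin_two,
      Q.apply_comm 1 0, hD]
    constructor <;> intro h <;> linarith
  refine IsGreatest.csSup_eq ⟨?_, ?_⟩
  · rw [mem_ofPred_eq, key]
    linear_combination hs
  · intro μ hμ
    rw [mem_ofPred_eq, key] at hμ
    have := Real.le_sqrt_of_sq_le hμ.le
    linarith

lemma continuous_lambdaMax_two : Continuous (lambdaMax : SymMat 2 → ℝ) := by
  have hc : ∀ i j, Continuous fun Q : SymMat 2 => Q.1 i j := fun i j =>
    continuous_subtype_val.matrix_elem i j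
  simp only [funext lambdaMax_two]
  exact (((hc 0 0).add (hc 1 1)).add (((((hc 0 0).sub (hc 1 1)).pow 2).add
    (((hc 0 1).pow 2).const_mul 4)).sqrt)).div_const 2

/-- Both sides say that `μ - Q` is positive semidefinite: nonnegative diagonal and determinant. All
monotonicity of the operator rests on this variational form. -/
lemma lambdaMax_le_iff (Q : SymMat 2) (μ : ℝ) :
    lambdaMax Q ≤ μ ↔ ∀ h, quadForm Q h ≤ μ * (h ⬝ᵥ h) := by
  have hdot : ∀ h : Fin 2 → ℝ, h ⬝ᵥ h = h 0 ^ 2 + h 1 ^ 2 := fun h => by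
    simp [dotProduct, Fin.sum_univ_two, sq]
  simp only [quadForm_two, hdot]
  rw [lambdaMax_two]
  set a := Q.1 0 0
  set b := Q.1 0 1
  set d := Q.1 1 1
  constructor
  · intro hle h
    have h1 : √((a - d) ^ 2 + 4 * b ^ 2) ≤ 2 * μ - a - d := by linarith
    have h0 : 0 ≤ 2 * μ - a - d := (Real.sqrt_nonneg _).trans h1
    have h2 : (a - d) ^ 2 + 4 * b ^ 2 ≤ (2 * μ - a - d) ^ 2 := (Real.sqrt_le_left h0).1 h1
    have h3 : b ^ 2 ≤ (μ - a) * (μ - d) := by linarith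
    have h4 : |a - d| ≤ 2 * μ - a - d := abs_le_of_sq_le_sq (by nlinarith [sq_nonneg b]) h0
    have ha : 0 ≤ μ - a := by linarith [le_abs_self (a - d)]
    have hd : 0 ≤ μ - d := by linarith [neg_abs_le (a - d)]
    have h5 : |b| ≤ √(μ - a) * √(μ - d) := by
      rw [← Real.sqrt_mul ha]
      exact Real.abs_le_sqrt h3
    have h6 : 2 * b * (h 0 * h 1) ≤ 2 * (√(μ - a) * √(μ - d)) * |h 0| * |h 1| := by
      calc 2 * b * (h 0 * h 1) ≤ |2 * b * (h 0 * h 1)| := le_abs_self _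
        _ = 2 * |b| * |h 0| * |h 1| := by simp [abs_mul]; ring
        _ ≤ _ := by gcongr
    have h7 := sq_nonneg (√(μ - a) * |h 0| - √(μ - d) * |h 1|)
    have h8 : (√(μ - a) * |h 0| - √(μ - d) * |h 1|) ^ 2 = (μ - a) * h 0 ^ 2 + (μ - d) * h 1 ^ 2
        - 2 * (√(μ - a) * √(μ - d)) * |h 0| * |h 1| := by
      rw [sub_sq, mul_pow, mul_pow, sq_abs, sq_abs, Real.sq_sqrt ha, Real.sq_sqrt hd]
      ring
    linarith
  · intro H
    have ha : a ≤ μ := by simpa using H ![1, 0]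
    have hd : d ≤ μ := by simpa using H ![0, 1]
    have hdisc : discrim (μ - a) (-(2 * b)) (μ - d) ≤ 0 := by
      refine discrim_le_zero fun x => ?_
      have := H ![x, 1]
      simp at this
      linarith
    have h1 : √((a - d) ^ 2 + 4 * b ^ 2) ≤ 2 * μ - a - d := by
      rw [Real.sqrt_le_left (by linarith)]
      simp only [discrim] at hdisc
      linarith
    linarith

lemma quadForm_le_lambdaMax (Q : SymMat 2) (h : Fin 2 → ℝ) :
    quadForm Q h ≤ lambdaMax Q * (h ⬝ᵥ h) :=
  (lambdaMax_le_iff Q _).1 le_rfl h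

lemma lambdaMax_mono {Q R : SymMat 2} (hQR : ∀ h, quadForm Q h ≤ quadForm R h) :
    lambdaMax Q ≤ lambdaMax R :=
  (lambdaMax_le_iff Q _).2 fun h => (hQR h).trans (quadForm_le_lambdaMax R h)

lemma trace_mono {Q R : SymMat 2} (hQR : ∀ h, quadForm Q h ≤ quadForm R h) :
    Q.1.trace ≤ R.1.trace := by
  have h0 := hQR ![1, 0]
  have h1 := hQR ![0, 1]
  simp only [quadForm_two] at h0 h1
  simp at h0 h1
  rw [Matrix.trace_fin_two, Matrix.trace_fin_two]
  linarith

/-! ### Rank-one perturbations and the positive part of the largest eigenvalue -/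

/-- The rank one matrix `m e₁ ⊗ e₁`. -/
def laminate (m : ℝ) : SymMat 2 :=
  ⟨Matrix.diagonal ![m, 0], Matrix.isHermitian_diagonal _⟩

lemma quadForm_laminate (m : ℝ) (h : Fin 2 → ℝ) : quadForm (laminate m) h = m * h 0 ^ 2 := by
  rw [quadForm_two]
  simp [laminate]

lemma trace_add_laminate (Q : SymMat 2) (m : ℝ) :
    (Q + laminate m).1.trace = Q.1.trace + m := by
  simp [laminate, Matrix.trace_add, Matrix.trace_fin_two]

lemma continuous_laminate : Continuous laminate := by
  refine Continuous.subtype_mk (Continuous.matrix_diagonal ?_) _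
  refine continuous_pi fun i => ?_
  fin_cases i <;> simp <;> fun_prop

lemma neg_laminate (m : ℝ) : -laminate m = laminate (-m) := by
  ext i j
  fin_cases i <;> fin_cases j <;> simp [laminate]

/-- The positive part of the largest eigenvalue. -/
noncomputable def lambdaPos (Q : SymMat 2) : ℝ := max (lambdaMax Q) 0

lemma lambdaPos_nonneg (Q : SymMat 2) : 0 ≤ lambdaPos Q := le_max_right _ _

lemma continuous_lambdaPos : Continuous lambdaPos := continuous_lambdaMax_two.max continuous_const

lemma lambdaPos_mono {Q R : SymMat 2} (hQR : ∀ h, quadForm Q h ≤ quadForm R h) :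
    lambdaPos Q ≤ lambdaPos R :=
  max_le_max (lambdaMax_mono hQR) le_rfl

lemma lambdaPos_add_laminate_mono (Q : SymMat 2) {m m' : ℝ} (h : m ≤ m') :
    lambdaPos (Q + laminate m) ≤ lambdaPos (Q + laminate m') := by
  refine lambdaPos_mono fun v => ?_
  simp only [quadForm_add, quadForm_laminate]
  gcongr

/-- `η h₀² ≤ η |h|²`. This bounds the error caused by perturbing the profile by `η`. -/
lemma lambdaPos_add_laminate_le (Q : SymMat 2) (m : ℝ) {η : ℝ} (hη : 0 ≤ η) :
    lambdaPos (Q + laminate (m + η)) ≤ lambdaPos (Q + laminate m) + η := by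
  refine max_le ?_ (add_nonneg (lambdaPos_nonneg _) hη)
  rw [lambdaMax_le_iff]
  intro h
  have h1 := quadForm_le_lambdaMax (Q + laminate m) h
  have h2 : lambdaMax (Q + laminate m) ≤ lambdaPos (Q + laminate m) := le_max_left _ _
  have h3 : h ⬝ᵥ h = h 0 ^ 2 + h 1 ^ 2 := by simp [dotProduct, Fin.sum_univ_two, sq]
  simp only [quadForm_add, quadForm_laminate] at h1 ⊢
  rw [h3] at h1 ⊢
  nlinarith [mul_nonneg hη (sq_nonneg (h 1)),
    mul_le_mul_of_nonneg_right h2 (add_nonneg (sq_nonneg (h 0)) (sq_nonneg (h 1)))]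

/-! ### The operator and its envelopes -/

lemma stripeOp_eq (b₀ : ℝ) (Q : SymMat 2) (y : Fin 2 → ℝ) :
    stripeOp b₀ Q y = Q.1.trace + stripeB b₀ y * lambdaPos Q := by
  simp [stripeOp, pucci, stripeA, lambdaPos]

lemma stripeB_nonneg {b₀ : ℝ} (hb₀ : 0 ≤ b₀) (y : Fin 2 → ℝ) : 0 ≤ stripeB b₀ y := by
  unfold stripeB
  split_ifs <;> simp [hb₀]

lemma stripeB_le {b₀ : ℝ} (hb₀ : 0 ≤ b₀) (y : Fin 2 → ℝ) : stripeB b₀ y ≤ b₀ := by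
  unfold stripeB
  split_ifs <;> simp [hb₀]

lemma stripeOp_mono {b₀ : ℝ} (hb₀ : 0 ≤ b₀) {Q R : SymMat 2}
    (hQR : ∀ h, quadForm Q h ≤ quadForm R h) (y : Fin 2 → ℝ) :
    stripeOp b₀ Q y ≤ stripeOp b₀ R y := by
  rw [stripeOp_eq, stripeOp_eq]
  exact add_le_add (trace_mono hQR)
    (mul_le_mul_of_nonneg_left (lambdaPos_mono hQR) (stripeB_nonneg hb₀ y))

lemma le_upperEnv {d : ℕ} (F : SymMat d → (Fin d → ℝ) → ℝ) (X : SymMat d) (y : Fin d → ℝ) :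
    (F X y : EReal) ≤ upperEnv F X y := by
  refine le_limsup_of_frequently_le ?_
  rw [frequently_iff]
  intro U hU
  exact ⟨(X, y), mem_of_mem_nhds hU, le_rfl⟩

lemma lowerEnv_le {d : ℕ} (F : SymMat d → (Fin d → ℝ) → ℝ) (X : SymMat d) (y : Fin d → ℝ) :
    lowerEnv F X y ≤ (F X y : EReal) := by
  refine liminf_le_of_frequently_le ?_
  rw [frequently_iff]
  intro U hU
  exact ⟨(X, y), mem_of_mem_nhds hU, le_rfl⟩

/-- The envelope is joint in matrix and point; a majorant free of the point leaves only a limit in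
the matrix, settled by continuity. -/
lemma upperEnv_le_of_eventually_le {d : ℕ} {F : SymMat d → (Fin d → ℝ) → ℝ} {g : SymMat d → ℝ}
    (hg : Continuous g) {X : SymMat d} {y : Fin d → ℝ}
    (h : ∀ᶠ z in 𝓝 y, ∀ Y, F Y z ≤ g Y) : upperEnv F X y ≤ (g X : EReal) := by
  have hlim : Tendsto (fun z : SymMat d × (Fin d → ℝ) => ((g z.1 : ℝ) : EReal)) (𝓝 (X, y))
      (𝓝 ((g X : ℝ) : EReal)) :=
    (continuous_coe_real_ereal.comp (hg.comp continuous_fst)).tendsto (X, y)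
  refine le_trans (limsup_le_limsup ?_) hlim.limsup_eq.le
  filter_upwards [(continuous_snd.tendsto (X, y)).eventually h] with z hz
  exact EReal.coe_le_coe_iff.2 (hz z.1)

lemma le_lowerEnv_of_eventually_le {d : ℕ} {F : SymMat d → (Fin d → ℝ) → ℝ} {g : SymMat d → ℝ}
    (hg : Continuous g) {X : SymMat d} {y : Fin d → ℝ}
    (h : ∀ᶠ z in 𝓝 y, ∀ Y, g Y ≤ F Y z) : (g X : EReal) ≤ lowerEnv F X y := by
  have hlim : Tendsto (fun z : SymMat d × (Fin d → ℝ) => ((g z.1 : ℝ) : EReal)) (𝓝 (X, y))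
      (𝓝 ((g X : ℝ) : EReal)) :=
    (continuous_coe_real_ereal.comp (hg.comp continuous_fst)).tendsto (X, y)
  refine le_trans hlim.liminf_eq.ge (liminf_le_liminf ?_)
  filter_upwards [(continuous_snd.tendsto (X, y)).eventually h] with z hz
  exact EReal.coe_le_coe_iff.2 (hz z.1)

lemma eventually_fract_mem_Ioo {x a b : ℝ} (ha : 0 ≤ a) (hb : b ≤ 1)
    (hx : Int.fract x ∈ Ioo a b) : ∀ᶠ z in 𝓝 x, Int.fract z ∈ Ioo a b := by
  have h0 := Int.floor_add_fract x
  have : Ioo (⌊x⌋ + a) (⌊x⌋ + b) ∈ 𝓝 x :=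
    Ioo_mem_nhds (by linarith [hx.1]) (by linarith [hx.2])
  filter_upwards [this] with z hz
  have hfl : ⌊z⌋ = ⌊x⌋ := Int.floor_eq_iff.2 ⟨by linarith [hz.1], by linarith [hz.2]⟩
  have h1 := Int.floor_add_fract z
  rw [hfl] at h1
  exact ⟨by linarith [hz.1], by linarith [hz.2]⟩

lemma continuous_trace_shift (Q : SymMat 2) : Continuous fun X : SymMat 2 => (Q + X).1.trace :=
  (continuous_subtype_val.comp (continuous_const.add continuous_id)).matrix_trace

lemma continuous_lambdaPos_shift (Q : SymMat 2) : Continuous fun X : SymMat 2 => lambdaPos (Q + X) :=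
  continuous_lambdaPos.comp (continuous_const.add continuous_id)

lemma upperEnv_stripeOp_le {b₀ : ℝ} (hb₀ : 0 ≤ b₀) (Q X : SymMat 2) (y : Fin 2 → ℝ) :
    upperEnv (fun X y => stripeOp b₀ (Q + X) y) X y ≤
      (((Q + X).1.trace + b₀ * lambdaPos (Q + X) : ℝ) : EReal) := by
  refine upperEnv_le_of_eventually_le (g := fun X => (Q + X).1.trace + b₀ * lambdaPos (Q + X))
    ((continuous_trace_shift Q).add (continuous_const.mul (continuous_lambdaPos_shift Q)))
    (.of_forall fun z Y => ?_)
  rw [stripeOp_eq]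
  gcongr
  · exact lambdaPos_nonneg _
  · exact stripeB_le hb₀ z

lemma upperEnv_stripeOp_le_of_fract {b₀ : ℝ} (Q X : SymMat 2) {y : Fin 2 → ℝ}
    (hy : Int.fract (y 0) ∈ Ioo (0 : ℝ) (1 / 2)) :
    upperEnv (fun X y => stripeOp b₀ (Q + X) y) X y ≤ (((Q + X).1.trace : ℝ) : EReal) := by
  refine upperEnv_le_of_eventually_le (g := fun X => (Q + X).1.trace) (continuous_trace_shift Q) ?_
  filter_upwards [(continuous_apply (0 : Fin 2)).continuousAt.eventually
    (eventually_fract_mem_Ioo le_rfl (by norm_num) hy)] with z hz Y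
  rw [stripeOp_eq, stripeB, if_pos hz.2]
  simp

lemma le_lowerEnv_stripeOp {b₀ : ℝ} (hb₀ : 0 ≤ b₀) (Q X : SymMat 2) (y : Fin 2 → ℝ) :
    (((Q + X).1.trace : ℝ) : EReal) ≤ lowerEnv (fun X y => stripeOp b₀ (Q + X) y) X y := by
  refine le_lowerEnv_of_eventually_le (g := fun X => (Q + X).1.trace) (continuous_trace_shift Q)
    (.of_forall fun z Y => ?_)
  rw [stripeOp_eq]
  exact le_add_of_nonneg_right (mul_nonneg (stripeB_nonneg hb₀ z) (lambdaPos_nonneg _))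

lemma le_lowerEnv_stripeOp_of_fract {b₀ : ℝ} (Q X : SymMat 2) {y : Fin 2 → ℝ}
    (hy : Int.fract (y 0) ∈ Ioo (1 / 2 : ℝ) 1) :
    (((Q + X).1.trace + b₀ * lambdaPos (Q + X) : ℝ) : EReal) ≤
      lowerEnv (fun X y => stripeOp b₀ (Q + X) y) X y := by
  refine le_lowerEnv_of_eventually_le (g := fun X => (Q + X).1.trace + b₀ * lambdaPos (Q + X))
    ((continuous_trace_shift Q).add (continuous_const.mul (continuous_lambdaPos_shift Q))) ?_
  filter_upwards [(continuous_apply (0 : Fin 2)).continuousAt.eventually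
    (eventually_fract_mem_Ioo (by norm_num) le_rfl hy)] with z hz Y
  rw [stripeOp_eq, stripeB, if_neg (not_lt.2 hz.1.le)]

/-! ### Piecewise quadratic profiles -/

/-- The `1`-periodic function vanishing at the half-integers whose second derivative is `m₁` on
the first half of each period and `m₂` on the second half. -/
noncomputable def profile (m₁ m₂ x : ℝ) : ℝ :=
  if Int.fract x < 1 / 2 then m₁ / 2 * (Int.fract x * (Int.fract x - 1 / 2))
  else m₂ / 2 * ((Int.fract x - 1 / 2) * (Int.fract x - 1))

lemma profile_neg (m₁ m₂ x : ℝ) : profile (-m₁) (-m₂) x = -profile m₁ m₂ x := by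
  unfold profile
  split_ifs <;> ring

lemma profile_add_int (m₁ m₂ x : ℝ) (n : ℤ) : profile m₁ m₂ (x + n) = profile m₁ m₂ x := by
  simp [profile]

lemma profile_eq_first (m₁ m₂ : ℝ) {x : ℝ} {n : ℤ} (h1 : (n : ℝ) ≤ x) (h2 : x ≤ n + 1 / 2) :
    profile m₁ m₂ x = m₁ / 2 * ((x - n) * (x - n - 1 / 2)) := by
  have hfl : ⌊x⌋ = n := Int.floor_eq_iff.2 ⟨h1, by linarith⟩
  have hfr : Int.fract x = x - n := by rw [Int.fract, hfl]
  rw [profile, hfr]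
  split_ifs with h
  · rfl
  · have : x - n = 1 / 2 := by linarith
    rw [this]
    ring

lemma profile_eq_second (m₁ m₂ : ℝ) {x : ℝ} {n : ℤ} (h1 : (n : ℝ) + 1 / 2 ≤ x) (h2 : x ≤ n + 1) :
    profile m₁ m₂ x = m₂ / 2 * ((x - n - 1 / 2) * (x - n - 1)) := by
  rcases h2.eq_or_lt with h2 | h2
  · rw [profile_eq_first (n := n + 1) _ _ (by push_cast; linarith) (by push_cast; linarith), h2]
    push_cast
    ring
  · have hfl : ⌊x⌋ = n := Int.floor_eq_iff.2 ⟨by linarith, h2⟩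
    have hfr : Int.fract x = x - n := by rw [Int.fract, hfl]
    rw [profile, hfr, if_neg (by linarith)]

/-- `v` is a quadratic polynomial with slope `a` and second derivative `m` at `x`, on a
neighborhood of `x` within the translate by `x` of `s`. -/
def QuadOn (v : ℝ → ℝ) (s : Set ℝ) (x a m : ℝ) : Prop :=
  ∀ᶠ t in 𝓝[s] 0, v (x + t) = v x + a * t + m / 2 * t ^ 2

/-- The parabola vanishes at both ends of the stripe, so its vertex is the midpoint `n + 1/4`, and
`n + 3/4` on the second stripe. -/
lemma quadOn_Ici_first (m₁ m₂ : ℝ) {x : ℝ} {n : ℤ} (h1 : (n : ℝ) ≤ x) (h2 : x < n + 1 / 2) :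
    QuadOn (profile m₁ m₂) (Ici 0) x (m₁ * (x - n - 1 / 4)) m₁ := by
  filter_upwards [Icc_mem_nhdsGE (show (0 : ℝ) < n + 1 / 2 - x by linarith)] with t ht
  rw [profile_eq_first _ _ h1 h2.le,
    profile_eq_first (n := n) _ _ (by linarith [ht.1]) (by linarith [ht.2])]
  ring

lemma quadOn_Ici_second (m₁ m₂ : ℝ) {x : ℝ} {n : ℤ} (h1 : (n : ℝ) + 1 / 2 ≤ x) (h2 : x < n + 1) :
    QuadOn (profile m₁ m₂) (Ici 0) x (m₂ * (x - n - 3 / 4)) m₂ := by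
  filter_upwards [Icc_mem_nhdsGE (show (0 : ℝ) < n + 1 - x by linarith)] with t ht
  rw [profile_eq_second _ _ h1 h2.le,
    profile_eq_second (n := n) _ _ (by linarith [ht.1]) (by linarith [ht.2])]
  ring

lemma quadOn_Iic_first (m₁ m₂ : ℝ) {x : ℝ} {n : ℤ} (h1 : (n : ℝ) < x) (h2 : x ≤ n + 1 / 2) :
    QuadOn (profile m₁ m₂) (Iic 0) x (m₁ * (x - n - 1 / 4)) m₁ := by
  filter_upwards [Icc_mem_nhdsLE (show n - x < (0 : ℝ) by linarith)] with t ht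
  rw [profile_eq_first _ _ h1.le h2,
    profile_eq_first (n := n) _ _ (by linarith [ht.1]) (by linarith [ht.2])]
  ring

lemma quadOn_Iic_second (m₁ m₂ : ℝ) {x : ℝ} {n : ℤ} (h1 : (n : ℝ) + 1 / 2 < x) (h2 : x ≤ n + 1) :
    QuadOn (profile m₁ m₂) (Iic 0) x (m₂ * (x - n - 3 / 4)) m₂ := by
  filter_upwards [Icc_mem_nhdsLE (show n + 1 / 2 - x < (0 : ℝ) by linarith)] with t ht
  rw [profile_eq_second _ _ h1.le h2,
    profile_eq_second (n := n) _ _ (by linarith [ht.1]) (by linarith [ht.2])]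
  ring

/-- At an interface the left slope is a quarter of the left second derivative and the right slope
minus a quarter of the right one. Hence the profile is `C¹` if `m₁ + m₂ = 0` and has concave kinks
if `m₁ + m₂ > 0`. The right second derivative follows the half-open convention of `stripeB`. -/
lemma profile_expansion (m₁ m₂ x : ℝ) : ∃ aL mL aR,
    QuadOn (profile m₁ m₂) (Iic 0) x aL mL ∧
    QuadOn (profile m₁ m₂) (Ici 0) x aR (if Int.fract x < 1 / 2 then m₁ else m₂) ∧
    (Int.fract x ∈ Ioo (0 : ℝ) (1 / 2) ∪ Ioo (1 / 2 : ℝ) 1 ∧ aL = aR ∧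
        mL = (if Int.fract x < 1 / 2 then m₁ else m₂) ∨
      aL - aR = (m₁ + m₂) / 4) := by
  have h0 := Int.floor_add_fract x
  have h1 := Int.fract_nonneg x
  have h2 := Int.fract_lt_one x
  by_cases hx : Int.fract x < 1 / 2
  · simp only [hx, if_true]
    rcases h1.eq_or_lt with h | h
    · refine ⟨_, _, _, quadOn_Iic_second (n := ⌊x⌋ - 1) m₁ m₂ ?_ ?_,
        quadOn_Ici_first (n := ⌊x⌋) m₁ m₂ ?_ ?_, .inr ?_⟩
      · push_cast; linarith
      · push_cast; linarith
      · linarith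
      · linarith
      · have : x = ⌊x⌋ := by linarith
        generalize ⌊x⌋ = n at this
        subst this
        push_cast
        ring
    · exact ⟨_, _, _, quadOn_Iic_first (n := ⌊x⌋) m₁ m₂ (by linarith) (by linarith),
        quadOn_Ici_first (n := ⌊x⌋) m₁ m₂ (by linarith) (by linarith),
        .inl ⟨.inl ⟨h, hx⟩, rfl, rfl⟩⟩
  · simp only [hx, if_false]
    rcases (not_lt.1 hx).eq_or_lt with h | h
    · refine ⟨_, _, _, quadOn_Iic_first (n := ⌊x⌋) m₁ m₂ ?_ ?_,
        quadOn_Ici_second (n := ⌊x⌋) m₁ m₂ ?_ ?_, .inr ?_⟩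
      · linarith
      · linarith
      · linarith
      · linarith
      · have : x = ⌊x⌋ + 1 / 2 := by linarith
        generalize ⌊x⌋ = n at this
        subst this
        ring
    · exact ⟨_, _, _, quadOn_Iic_second (n := ⌊x⌋) m₁ m₂ (by linarith) (by linarith),
        quadOn_Ici_second (n := ⌊x⌋) m₁ m₂ (by linarith) (by linarith),
        .inl ⟨.inr ⟨h, h2⟩, rfl, rfl⟩⟩

lemma QuadOn.tendsto {v : ℝ → ℝ} {s : Set ℝ} {x a m : ℝ} (h : QuadOn v s x a m) :
    Tendsto (fun t => v (x + t)) (𝓝[s] 0) (𝓝 (v x)) := by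
  have hc : Continuous fun t : ℝ => v x + a * t + m / 2 * t ^ 2 := by fun_prop
  have := (hc.tendsto 0).mono_left (nhdsWithin_le_nhds (s := s))
  simp only [mul_zero, add_zero, ne_eq, OfNat.ofNat_ne_zero, not_false_eq_true, zero_pow] at this
  exact this.congr' (h.mono fun t ht => ht.symm)

lemma continuous_profile (m₁ m₂ : ℝ) : Continuous (profile m₁ m₂) := by
  refine continuous_iff_continuousAt.2 fun x => ?_
  obtain ⟨aL, mL, aR, hL, hR, -⟩ := profile_expansion m₁ m₂ x
  have h := hL.tendsto.sup hR.tendsto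
  rw [← nhdsWithin_union, Iic_union_Ici, nhdsWithin_univ] at h
  have h' : Tendsto (fun z => z - x) (𝓝 x) (𝓝 0) := by
    have hc : Continuous fun z : ℝ => z - x := by fun_prop
    simpa using hc.tendsto x
  simpa [ContinuousAt, Function.comp_def] using h.comp h'

lemma QuadOn.le_of_kink {v : ℝ → ℝ} {x aL mL aR mR : ℝ} (hL : QuadOn v (Iic 0) x aL mL)
    (hR : QuadOn v (Ici 0) x aR mR) (hlt : aR < aL) (m : ℝ) :
    ∃ p, ∀ᶠ t in 𝓝 0, v (x + t) ≤ v x + p * t + m / 2 * t ^ 2 := by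
  -- With the mean slope, the kink leaves a gap `(aL - aR) / 2 * |t|`, which beats every quadratic
  -- term near `0`.
  refine ⟨(aL + aR) / 2, ?_⟩
  rw [QuadOn, eventually_nhdsWithin_iff] at hL hR
  have h1 : ∀ᶠ t in 𝓝 (0 : ℝ), (mL / 2 - m / 2) * t > -((aL - aR) / 2) := by
    have : Tendsto (fun t : ℝ => (mL / 2 - m / 2) * t) (𝓝 0) (𝓝 ((mL / 2 - m / 2) * 0)) :=
      (continuous_const.mul continuous_id).tendsto 0
    exact this.eventually_const_lt (by simp; linarith)
  have h2 : ∀ᶠ t in 𝓝 (0 : ℝ), (mR / 2 - m / 2) * t < (aL - aR) / 2 := by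
    have : Tendsto (fun t : ℝ => (mR / 2 - m / 2) * t) (𝓝 0) (𝓝 ((mR / 2 - m / 2) * 0)) :=
      (continuous_const.mul continuous_id).tendsto 0
    exact this.eventually_lt_const (by simp; linarith)
  filter_upwards [hL, hR, h1, h2] with t h3 h4 h5 h6
  rcases le_total t 0 with ht | ht
  · rw [h3 ht]
    nlinarith
  · rw [h4 ht]
    nlinarith

/-- A profile with concave kinks is touched from above at any point by parabolas. -/
lemma profile_touched_above {m₁ m₂ : ℝ} (hm : 0 < m₁ + m₂) (x : ℝ) :
    Int.fract x ∈ Ioo (0 : ℝ) (1 / 2) ∧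
        (∃ p, ∀ᶠ t in 𝓝 0, profile m₁ m₂ (x + t) ≤ profile m₁ m₂ x + p * t + m₁ / 2 * t ^ 2) ∨
      Int.fract x ∈ Ioo (1 / 2 : ℝ) 1 ∧
        (∃ p, ∀ᶠ t in 𝓝 0, profile m₁ m₂ (x + t) ≤ profile m₁ m₂ x + p * t + m₂ / 2 * t ^ 2) ∨
      ∀ m, ∃ p, ∀ᶠ t in 𝓝 0, profile m₁ m₂ (x + t) ≤ profile m₁ m₂ x + p * t + m / 2 * t ^ 2 := by
  obtain ⟨aL, mL, aR, hL, hR, ⟨hx, rfl, rfl⟩ | h⟩ := profile_expansion m₁ m₂ x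
  · have h := eventually_sup.2 ⟨hL, hR⟩
    rw [← nhdsWithin_union, Iic_union_Ici, nhdsWithin_univ] at h
    rcases hx with hx | hx
    · rw [if_pos hx.2] at h
      exact .inl ⟨hx, aL, h.mono fun t ht => ht.le⟩
    · rw [if_neg (not_lt.2 hx.1.le)] at h
      exact .inr (.inl ⟨hx, aL, h.mono fun t ht => ht.le⟩)
  · exact .inr (.inr fun m => hL.le_of_kink hR (by linarith) m)

/-! ### Jets -/

lemma isSubjet_iff_isSuperjet_neg {d : ℕ} (u : (Fin d → ℝ) → ℝ) (y : Fin d → ℝ) (X : SymMat d) :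
    IsSubjet u y X ↔ IsSuperjet (fun z => -u z) y (-X) := by
  constructor
  · rintro ⟨p, hp⟩
    refine ⟨-p, fun ε hε => (hp ε hε).mono fun h hh => ?_⟩
    have := quadForm_neg X h
    simp only [quadForm] at this
    simp only [neg_dotProduct, this]
    linarith
  · rintro ⟨p, hp⟩
    refine ⟨-p, fun ε hε => (hp ε hε).mono fun h hh => ?_⟩
    have := quadForm_neg X h
    simp only [quadForm] at this
    simp only [this] at hh
    simp only [neg_dotProduct]
    linarith

lemma isSuperjet_laminate_of_touching {u : (Fin 2 → ℝ) → ℝ} {v : ℝ → ℝ} {y : Fin 2 → ℝ}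
    (hmax : ∀ z, u z - v (z 0) ≤ u y - v (y 0)) {m p : ℝ}
    (hv : ∀ᶠ t in 𝓝 0, v (y 0 + t) ≤ v (y 0) + p * t + m / 2 * t ^ 2) :
    IsSuperjet u y (laminate m) := by
  refine ⟨![p, 0], fun ε hε => ?_⟩
  have h0 : Tendsto (fun h : Fin 2 → ℝ => h 0) (𝓝 0) (𝓝 0) :=
    (continuous_apply (0 : Fin 2)).tendsto (0 : Fin 2 → ℝ)
  filter_upwards [h0.eventually hv] with h hh
  have h1 := hmax (y + h)
  have h2 := quadForm_laminate m h
  have h3 : 0 ≤ h ⬝ᵥ h := by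
    simp only [dotProduct, Fin.sum_univ_two]
    exact add_nonneg (mul_self_nonneg _) (mul_self_nonneg _)
  have h4 : ![p, 0] ⬝ᵥ h = p * h 0 := by simp [dotProduct, Fin.sum_univ_two]
  rw [quadForm] at h2
  rw [h2, h4]
  simp only [Pi.add_apply] at h1
  nlinarith [mul_nonneg hε.le h3]

lemma le_of_eventually_quadratic_le {a b a' b' : ℝ}
    (h : ∀ᶠ t in 𝓝[>] (0 : ℝ), a * t + b * t ^ 2 ≤ a' * t + b' * t ^ 2) : a ≤ a' := by
  have h1 : ∀ c d : ℝ, Tendsto (fun t : ℝ => c + d * t) (𝓝[>] 0) (𝓝 c) := fun c d => by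
    have hc : Continuous fun t : ℝ => c + d * t := by fun_prop
    simpa using (hc.tendsto 0).mono_left (nhdsWithin_le_nhds (s := Ioi 0))
  refine le_of_tendsto_of_tendsto (h1 a b) (h1 a' b') ?_
  filter_upwards [h, self_mem_nhdsWithin] with t ht (ht0 : 0 < t)
  nlinarith

lemma le_of_eventually_quadratic_le' {a b b' : ℝ}
    (h : ∀ᶠ t in 𝓝[>] (0 : ℝ), a * t + b * t ^ 2 ≤ a * t + b' * t ^ 2) : b ≤ b' := by
  obtain ⟨t, ht, ht0⟩ := (h.and self_mem_nhdsWithin).exists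
  have : 0 < t ^ 2 := pow_pos ht0 2
  nlinarith

lemma superjet_ray {u : (Fin 2 → ℝ) → ℝ} {v : ℝ → ℝ} (huv : ∀ y, u y = v (y 0)) {y p : Fin 2 → ℝ}
    {X : SymMat 2} {aL mL aR mR ε : ℝ} (hL : QuadOn v (Iic 0) (y 0) aL mL)
    (hR : QuadOn v (Ici 0) (y 0) aR mR)
    (hp : ∀ᶠ h in 𝓝 (0 : Fin 2 → ℝ), u (y + h) ≤ u y + p ⬝ᵥ h
      + (1 / 2) * (h ⬝ᵥ (X.1.mulVec h)) + ε * (h ⬝ᵥ h)) (h : Fin 2 → ℝ) :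
    ∀ᶠ t in 𝓝[>] (0 : ℝ),
      (if 0 ≤ h 0 then aR * h 0 else aL * h 0) * t
        + (if 0 ≤ h 0 then mR / 2 * h 0 ^ 2 else mL / 2 * h 0 ^ 2) * t ^ 2 ≤
      (p ⬝ᵥ h) * t + (quadForm X h / 2 + ε * (h ⬝ᵥ h)) * t ^ 2 := by
  have hc : Tendsto (fun t : ℝ => t • h) (𝓝[>] 0) (𝓝 0) := by
    have : Continuous fun t : ℝ => t • h := by fun_prop
    simpa using (this.tendsto 0).mono_left (nhdsWithin_le_nhds (s := Ioi 0))
  have hc0 : Tendsto (fun t : ℝ => t * h 0) (𝓝[>] 0) (𝓝 0) := by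
    have : Continuous fun t : ℝ => t * h 0 := by fun_prop
    simpa using (this.tendsto 0).mono_left (nhdsWithin_le_nhds (s := Ioi 0))
  rw [QuadOn, eventually_nhdsWithin_iff] at hL hR
  filter_upwards [hc.eventually hp, hc0.eventually hL, hc0.eventually hR, self_mem_nhdsWithin]
    with t h1 h2 h3 (h4 : 0 < t)
  have h5 := quadForm_smul_vec X t h
  rw [quadForm] at h5
  rw [huv, huv, h5] at h1
  simp only [Pi.add_apply, Pi.smul_apply, smul_eq_mul, dotProduct_smul, smul_dotProduct] at h1
  split_ifs with h0
  · rw [h3 (mul_nonneg h4.le h0)] at h1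
    linarith
  · rw [h2 (mul_nonpos_of_nonneg_of_nonpos h4.le (not_le.1 h0).le)] at h1
    linarith

/-- Superjets of a differentiable, piecewise quadratic laminate lie above its one-sided second
derivatives. -/
lemma quadForm_le_of_isSuperjet {u : (Fin 2 → ℝ) → ℝ} {v : ℝ → ℝ} (huv : ∀ y, u y = v (y 0))
    {y : Fin 2 → ℝ} {X : SymMat 2} {a mL mR : ℝ} (hL : QuadOn v (Iic 0) (y 0) a mL)
    (hR : QuadOn v (Ici 0) (y 0) a mR) (hX : IsSuperjet u y X) (h : Fin 2 → ℝ) :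
    quadForm (laminate mR) h ≤ quadForm X h := by
  obtain ⟨p, hp⟩ := hX
  have hle : ∀ h : Fin 2 → ℝ, a * h 0 ≤ p ⬝ᵥ h := fun h => by
    have := le_of_eventually_quadratic_le (superjet_ray huv hL hR (hp 1 one_pos) h)
    simpa using this
  -- The first-order inequality for `h` and `-h` forces `p = a e₁`, so the linear terms cancel.
  have heq : ∀ h : Fin 2 → ℝ, p ⬝ᵥ h = a * h 0 := fun h => by
    refine le_antisymm ?_ (hle h)
    have := hle (-h)
    simp only [Pi.neg_apply, dotProduct_neg] at this
    linarith
  have main : ∀ h : Fin 2 → ℝ, 0 ≤ h 0 → quadForm (laminate mR) h ≤ quadForm X h := by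
    intro h h0
    have key : ∀ ε : ℝ, 0 < ε → mR / 2 * h 0 ^ 2 ≤ quadForm X h / 2 + ε * (h ⬝ᵥ h) := by
      intro ε hε
      have := superjet_ray huv hL hR (hp ε hε) h
      simp only [h0, if_true, heq] at this
      exact le_of_eventually_quadratic_le' this
    have hlim : Tendsto (fun ε : ℝ => quadForm X h / 2 + ε * (h ⬝ᵥ h)) (𝓝[>] 0)
        (𝓝 (quadForm X h / 2)) := by
      have : Continuous fun ε : ℝ => quadForm X h / 2 + ε * (h ⬝ᵥ h) := by fun_prop
      simpa using (this.tendsto 0).mono_left (nhdsWithin_le_nhds (s := Ioi 0))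
    have := ge_of_tendsto hlim (eventually_nhdsWithin_of_forall key)
    rw [quadForm_laminate]
    linarith
  -- Quadratic forms are even, so the right half-plane suffices.
  rcases le_total 0 (h 0) with h0 | h0
  · exact main h h0
  · have := main ((-1 : ℝ) • h) (by simpa using h0)
    simpa only [quadForm_smul_vec, neg_one_sq, one_mul] using this

/-! ### The cell problem -/

lemma exists_isMax_of_periodic {u : (Fin 2 → ℝ) → ℝ} (hu : Continuous u) (hper : IsPeriodic u) :
    ∃ y, ∀ z, u z ≤ u y := by
  obtain ⟨y, -, hy⟩ := (isCompact_Icc (a := (0 : Fin 2 → ℝ)) (b := 1)).exists_isMaxOn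
    ⟨0, by simp⟩ hu.continuousOn
  refine ⟨y, fun z => ?_⟩
  have hz : z = (fun i => Int.fract (z i)) + fun i => ((⌊z i⌋ : ℤ) : ℝ) := by
    ext i
    simp [Int.fract_add_floor]
  rw [hz, hper _ fun i => ⌊z i⌋]
  exact hy ⟨fun i => Int.fract_nonneg _, fun i => (Int.fract_lt_one _).le⟩

lemma exists_isMax_sub_profile {u : (Fin 2 → ℝ) → ℝ} (hu : Continuous u) (hper : IsPeriodic u)
    (m₁ m₂ : ℝ) : ∃ y, ∀ z, u z - profile m₁ m₂ (z 0) ≤ u y - profile m₁ m₂ (y 0) := by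
  refine exists_isMax_of_periodic (u := fun z => u z - profile m₁ m₂ (z 0))
    (hu.sub ((continuous_profile m₁ m₂).comp (continuous_apply 0))) fun y k => ?_
  simp only [Pi.add_apply, profile_add_int, hper y k]

/-- The relation determining the second derivative `± s` of the laminate corrector. -/
def IsCorrectorSlope (b₀ : ℝ) (Q : SymMat 2) (s : ℝ) : Prop :=
  0 ≤ s ∧ 2 * s = b₀ * lambdaPos (Q + laminate (-s))

lemma exists_isCorrectorSlope {b₀ : ℝ} (hb₀ : 0 ≤ b₀) (Q : SymMat 2) :
    ∃ s, IsCorrectorSlope b₀ Q s := by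
  set f : ℝ → ℝ := fun s => 2 * s - b₀ * lambdaPos (Q + laminate (-s)) with hf
  have hc : Continuous f := (continuous_const.mul continuous_id).sub (continuous_const.mul
    ((continuous_lambdaPos_shift Q).comp (continuous_laminate.comp continuous_neg)))
  set S := b₀ * lambdaPos (Q + laminate 0) / 2 with hS
  have hS0 : 0 ≤ S := by
    have := mul_nonneg hb₀ (lambdaPos_nonneg (Q + laminate 0))
    linarith
  have h0 : f 0 ≤ 0 := by
    have := mul_nonneg hb₀ (lambdaPos_nonneg (Q + laminate 0))
    simp only [hf, neg_zero]
    linarith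
  have h1 : 0 ≤ f S := by
    have := mul_le_mul_of_nonneg_left
      (lambdaPos_add_laminate_mono Q (show -S ≤ 0 by linarith)) hb₀
    simp only [hf]
    linarith
  obtain ⟨s, hs, hfs⟩ := intermediate_value_Icc hS0 hc.continuousOn ⟨h0, h1⟩
  refine ⟨s, hs.1, ?_⟩
  simp only [hf] at hfs
  linarith

lemma IsCorrectorSlope.isCellValue {b₀ : ℝ} (hb₀ : 0 ≤ b₀) {Q : SymMat 2} {s : ℝ}
    (hs : IsCorrectorSlope b₀ Q s) : IsCellValue (stripeOp b₀) Q (Q.1.trace + s) := by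
  obtain ⟨hs0, hs⟩ := hs
  -- The equation holds pointwise, even on the interfaces, with the one-sided second derivative from
  -- the right. Jets are ordered against that derivative, so monotonicity suffices.
  have hF : ∀ (y : Fin 2 → ℝ), stripeOp b₀ (Q + laminate
      (if Int.fract (y 0) < 1 / 2 then s else -s)) y = Q.1.trace + s := by
    intro y
    rw [stripeOp_eq, stripeB, trace_add_laminate]
    split_ifs
    · simp
    · linarith
  have hjet : ∀ (m : ℝ) (y : Fin 2 → ℝ) (X : SymMat 2),
      IsSuperjet (fun z => profile m (-m) (z 0)) y X →
      ∀ h, quadForm (laminate (if Int.fract (y 0) < 1 / 2 then m else -m)) h ≤ quadForm X h := by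
    intro m y X hX h
    obtain ⟨aL, mL, aR, hL, hR, hLR⟩ := profile_expansion m (-m) (y 0)
    have : aL = aR := by
      rcases hLR with hLR | hLR
      · exact hLR.2.1
      · linarith
    subst this
    exact quadForm_le_of_isSuperjet (fun _ => rfl) hL hR hX h
  refine ⟨fun z => profile s (-s) (z 0), fun y k => ?_, ?_, ?_, ?_⟩
  · simp only [Pi.add_apply, profile_add_int]
  · exact (continuous_profile s (-s)).comp (continuous_apply 0)
  · intro y X hX
    refine le_trans (EReal.coe_le_coe_iff.2 ?_) (le_upperEnv _ X y)
    rw [← hF y]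
    refine stripeOp_mono hb₀ (fun h => ?_) y
    simp only [quadForm_add]
    linarith [hjet s y X hX h]
  · intro y X hX
    refine le_trans (lowerEnv_le _ X y) (EReal.coe_le_coe_iff.2 ?_)
    rw [← hF y]
    refine stripeOp_mono hb₀ (fun h => ?_) y
    rw [isSubjet_iff_isSuperjet_neg] at hX
    simp only [← profile_neg] at hX
    have h1 := hjet (-s) y (-X) hX h
    rw [quadForm_neg] at h1
    simp only [quadForm_add, quadForm_laminate] at h1 ⊢
    split_ifs at h1 ⊢ <;> linarith

lemma IsCorrectorSlope.cellValue_le {b₀ : ℝ} (hb₀ : 0 ≤ b₀) {Q : SymMat 2} {s c : ℝ}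
    (hs : IsCorrectorSlope b₀ Q s) (hc : IsCellValue (stripeOp b₀) Q c) : c ≤ Q.1.trace + s := by
  obtain ⟨hs0, hs⟩ := hs
  obtain ⟨u, hper, hu⟩ := hc
  have key : ∀ η : ℝ, 0 < η → c ≤ Q.1.trace + s + (1 + b₀) * η := by
    intro η hη
    obtain ⟨y, hy⟩ := exists_isMax_sub_profile hu.continuous hper (s + η) (-s + η)
    -- Serves the second stripe and the kinks alike: the envelope bound with coefficient `b₀` is
    -- valid everywhere, and at a kink the second derivative `-s + η` may be chosen.
    have h2 : (∃ p, ∀ᶠ t in 𝓝 0, profile (s + η) (-s + η) (y 0 + t) ≤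
        profile (s + η) (-s + η) (y 0) + p * t + (-s + η) / 2 * t ^ 2) →
        c ≤ Q.1.trace + s + (1 + b₀) * η := by
      rintro ⟨p, hp⟩
      have h3 := (hu.subsolution y _ (isSuperjet_laminate_of_touching hy hp)).trans
        (upperEnv_stripeOp_le hb₀ Q _ y)
      rw [EReal.coe_le_coe_iff, trace_add_laminate] at h3
      have h4 := mul_le_mul_of_nonneg_left (lambdaPos_add_laminate_le Q (-s) hη.le) hb₀
      linarith
    rcases profile_touched_above (m₁ := s + η) (m₂ := -s + η) (by linarith) (y 0) with
      ⟨hfr, p, hp⟩ | ⟨-, hp⟩ | hp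
    · have h3 := (hu.subsolution y _ (isSuperjet_laminate_of_touching hy hp)).trans
        (upperEnv_stripeOp_le_of_fract Q _ hfr)
      rw [EReal.coe_le_coe_iff, trace_add_laminate] at h3
      linarith [mul_nonneg hb₀ hη.le]
    · exact h2 hp
    · exact h2 (hp _)
  refine le_of_forall_pos_le_add fun ε hε => ?_
  have h := key (ε / (1 + b₀)) (by positivity)
  rwa [mul_div_cancel₀ _ (by positivity)] at h

lemma IsCorrectorSlope.le_cellValue {b₀ : ℝ} (hb₀ : 0 ≤ b₀) {Q : SymMat 2} {s c : ℝ}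
    (hs : IsCorrectorSlope b₀ Q s) (hc : IsCellValue (stripeOp b₀) Q c) : Q.1.trace + s ≤ c := by
  obtain ⟨hs0, hs⟩ := hs
  obtain ⟨u, hper, hu⟩ := hc
  have hper' : IsPeriodic fun z => -u z := fun y k => congrArg Neg.neg (hper y k)
  have key : ∀ η : ℝ, 0 < η → Q.1.trace + s ≤ c + (1 + b₀) * η := by
    intro η hη
    obtain ⟨y, hy⟩ := exists_isMax_sub_profile hu.continuous.neg hper' (-s + η) (s + η)
    have hsub : ∀ m p : ℝ, (∀ᶠ t in 𝓝 0, profile (-s + η) (s + η) (y 0 + t) ≤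
        profile (-s + η) (s + η) (y 0) + p * t + m / 2 * t ^ 2) →
        lowerEnv (fun X y => stripeOp b₀ (Q + X) y) (laminate (-m)) y ≤ c := by
      intro m p hp
      refine hu.supersolution y _ ?_
      rw [isSubjet_iff_isSuperjet_neg, neg_laminate, neg_neg]
      exact isSuperjet_laminate_of_touching hy hp
    -- Here the bound valid everywhere is the trace, so the kinks go with the first stripe.
    have h2 : (∃ p, ∀ᶠ t in 𝓝 0, profile (-s + η) (s + η) (y 0 + t) ≤
        profile (-s + η) (s + η) (y 0) + p * t + (-s + η) / 2 * t ^ 2) →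
        Q.1.trace + s ≤ c + (1 + b₀) * η := by
      rintro ⟨p, hp⟩
      have h3 := (le_lowerEnv_stripeOp hb₀ Q _ y).trans (hsub _ p hp)
      rw [EReal.coe_le_coe_iff, trace_add_laminate] at h3
      linarith [mul_nonneg hb₀ hη.le]
    rcases profile_touched_above (m₁ := -s + η) (m₂ := s + η) (by linarith) (y 0) with
      ⟨-, hp⟩ | ⟨hfr, p, hp⟩ | hp
    · exact h2 hp
    · have h3 := (le_lowerEnv_stripeOp_of_fract Q _ hfr).trans (hsub _ p hp)
      rw [EReal.coe_le_coe_iff, trace_add_laminate] at h3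
      have h4 := mul_le_mul_of_nonneg_left (lambdaPos_add_laminate_le Q (-(s + η)) hη.le) hb₀
      rw [show -(s + η) + η = -s by ring] at h4
      linarith
    · exact h2 (hp _)
  refine le_of_forall_pos_le_add fun ε hε => ?_
  have h := key (ε / (1 + b₀)) (by positivity)
  rwa [mul_div_cancel₀ _ (by positivity)] at h

/-! ### The explicit lower bound and the negative semidefinite case -/

lemma IsCorrectorSlope.stripeL_le {b₀ : ℝ} (hb₀ : 0 ≤ b₀) {Q : SymMat 2} {s : ℝ}
    (hs : IsCorrectorSlope b₀ Q s) {t : ℝ} (ht : t ∈ Icc (0 : ℝ) 1) :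
    stripeL b₀ Q t ≤ Q.1.trace + s := by
  obtain ⟨hs0, hs⟩ := hs
  have ht0 := ht.1
  have ht1 : 0 ≤ 1 - t := by linarith [ht.2]
  have h1 := quadForm_le_lambdaMax (Q + laminate (-s)) ![√t, √(1 - t)]
  have h2 : lambdaMax (Q + laminate (-s)) ≤ lambdaPos (Q + laminate (-s)) := le_max_left _ _
  have h3 : √(t - t ^ 2) = √t * √(1 - t) := by
    rw [← Real.sqrt_mul ht0]
    ring_nf
  rw [quadForm_add, quadForm_laminate, quadForm_two] at h1
  simp only [Matrix.cons_val_zero, Matrix.cons_val_one, dotProduct, Fin.sum_univ_two,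
    Real.mul_self_sqrt ht0, Real.mul_self_sqrt ht1, Real.sq_sqrt ht0, Real.sq_sqrt ht1] at h1
  rw [stripeL, h3]
  -- The test vector gives `2s ≥ b₀ (q - s t)`, with `q` the value of the form of `Q` on it.
  have h4 : b₀ * (Q.1 1 1 + t * (Q.1 0 0 - Q.1 1 1) + 2 * Q.1 0 1 * (√t * √(1 - t)))
      ≤ s * (2 + b₀ * t) := by
    have := mul_le_mul_of_nonneg_left (h1.trans (by linarith : _ ≤ lambdaPos (Q + laminate (-s))))
      hb₀
    linarith
  have hpos : 0 < 2 + b₀ * t := by positivity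
  rw [div_mul_eq_mul_div]
  have := (div_le_iff₀ hpos).2 h4
  linarith

lemma lambdaPos_eq_zero_of_neg_posSemidef {Q : SymMat 2}
    (hQ : (-(Q : Matrix (Fin 2) (Fin 2) ℝ)).PosSemidef) : lambdaPos Q = 0 := by
  refine max_eq_right ((lambdaMax_le_iff Q 0).2 fun h => ?_)
  have := hQ.dotProduct_mulVec_nonneg h
  simp only [star_trivial, Matrix.neg_mulVec, dotProduct_neg] at this
  rw [quadForm]
  linarith

lemma harmonicMean_stripeA : harmonicMean stripeA = 1 := by
  simp [harmonicMean, stripeA, Measure.real, Real.volume_Icc_pi]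

end StripeHomog

theorem mainTheorem3 (b₀ : ℝ) (hb₀ : 0 ≤ b₀) :
    ∃ Fbar : StripeHomog.SymMat 2 → ℝ,
      (∀ (Q : StripeHomog.SymMat 2) (c : ℝ),
        StripeHomog.IsCellValue (StripeHomog.stripeOp b₀) Q c ↔ c = Fbar Q) ∧
      (∀ Q : StripeHomog.SymMat 2, ¬ (-(Q : Matrix (Fin 2) (Fin 2) ℝ)).PosSemidef →
        BddAbove (StripeHomog.stripeL b₀ Q '' Set.Icc 0 1) ∧
        sSup (StripeHomog.stripeL b₀ Q '' Set.Icc 0 1) ≤ Fbar Q) ∧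
      (∀ Q : StripeHomog.SymMat 2, (-(Q : Matrix (Fin 2) (Fin 2) ℝ)).PosSemidef →
        (∀ y : Fin 2 → ℝ,
          StripeHomog.stripeOp b₀ Q y = (Q : Matrix (Fin 2) (Fin 2) ℝ).trace) ∧
        Fbar Q = StripeHomog.harmonicMean StripeHomog.stripeA *
          (Q : Matrix (Fin 2) (Fin 2) ℝ).trace ∧
        Fbar Q = (Q : Matrix (Fin 2) (Fin 2) ℝ).trace) := by
  choose s hs using fun Q => StripeHomog.exists_isCorrectorSlope hb₀ Q
  refine ⟨fun Q => Q.1.trace + s Q, fun Q c => ⟨fun hc => ?_, ?_⟩, fun Q _ => ?_, fun Q hQ => ?_⟩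
  · exact le_antisymm ((hs Q).cellValue_le hb₀ hc) ((hs Q).le_cellValue hb₀ hc)
  · rintro rfl
    exact (hs Q).isCellValue hb₀
  · have hle : ∀ a ∈ StripeHomog.stripeL b₀ Q '' Set.Icc 0 1, a ≤ Q.1.trace + s Q := by
      rintro _ ⟨t, ht, rfl⟩
      exact (hs Q).stripeL_le hb₀ ht
    exact ⟨⟨_, hle⟩, csSup_le (Set.Nonempty.image _ ⟨0, by simp⟩) hle⟩
  · have h0 := StripeHomog.lambdaPos_eq_zero_of_neg_posSemidef hQ
    have hs0 : s Q = 0 := by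
      obtain ⟨h1, h2⟩ := hs Q
      have h3 : StripeHomog.lambdaPos (Q + StripeHomog.laminate (-s Q)) ≤
          StripeHomog.lambdaPos Q := by
        refine StripeHomog.lambdaPos_mono fun v => ?_
        rw [StripeHomog.quadForm_add, StripeHomog.quadForm_laminate]
        nlinarith [sq_nonneg (v 0)]
      have := mul_le_mul_of_nonneg_left h3 hb₀
      rw [h0] at this
      linarith
    refine ⟨fun y => ?_, ?_, ?_⟩
    · rw [StripeHomog.stripeOp_eq, h0]
      simp
    · simp [hs0, StripeHomog.harmonicMean_stripeA]
    · simp [hs0]
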